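/- Let $H$ be a separable complex Hilbert space, let $A\subseteq B(H)$ be a subalgebra that contains the identity and is closed in the weak-* topology of $B(H)$ (the ultraweak topology, given by the duality of $B(H)$ with the trace class operators), and let $J\subseteq A$ be a weak-* closed two-sided ideal. Then there is a closed subspace $E$ of the Hilbert space tensor product $\ell_2\otimes H$ such that $$\widehat\Psi: A/J\to B(E),\qquad \widehat\Psi(a+J)=P_E\,(I_{\ell_2}\otimes a)|_E ,$$ is a well-defined completely isometric representation of $A/J$. That is, $\widehat\Psi$ is a unital algebra homomorphism, and for every $k\ge 1$ and every matrix $x=(x_{ij})\in M_k(A/J)$, $$\bigl\|(\widehat\Psi(x_{ij}))_{ij}\bigr\|_{B(\ell_2^k(E))}=\inf\bigl\{\|(y_{ij})_{ij}\|_{B(\ell_2^k(H))} : y_{ij}\in A,\ y_{ij}+J=x_{ij}\bigr\},$$ where the right-hand side is the quotient norm on $M_k(A/J)=M_k(A)/M_k(J)$. Here $P_E$ is the orthogonal projection of $\ell_2\otimes H$ onto $E$. -/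

import Mathlib

open scoped TensorProduct

noncomputable section

namespace DualAlgebra

/-- The weak-star (ultraweak) topology on `B(H)`, i.e. the topology induced by the duality of `B(H)`
with the trace class operators. The normal functionals are exactly the maps
`T ↦ ∑ n, ⟪y n, T (x n)⟫` with `∑ ‖x n‖² < ∞` and `∑ ‖y n‖² < ∞`, and this is the coarsest
topology making all of them continuous. -/
@[reducible] def weakStar (H : Type*) [NormedAddCommGroup H] [InnerProductSpace ℂ H] :
    TopologicalSpace (H →L[ℂ] H) :=
  TopologicalSpace.induced
    (fun (T : H →L[ℂ] H) (p : lp (fun _ : ℕ => H) 2 × lp (fun _ : ℕ => H) 2) =>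
      ∑' n, inner ℂ (p.2 n) (T (p.1 n)))
    inferInstance

/-- Closedness in the weak-star topology of `B(H)`. -/
def IsWeakStarClosed {H : Type*} [NormedAddCommGroup H] [InnerProductSpace ℂ H]
    (S : Set (H →L[ℂ] H)) : Prop :=
  @IsClosed _ (weakStar H) S

/-- The Hilbert space tensor product `ℓ₂ ⊗ H`: the completion of the algebraic tensor product
with the inner product `⟪x ⊗ h, y ⊗ k⟫ = ⟪x, y⟫ ⟪h, k⟫`. -/
abbrev EllTwoTensor (H : Type*) [NormedAddCommGroup H] [InnerProductSpace ℂ H] : Type _ :=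
  UniformSpace.Completion (lp (fun _ : ℕ => ℂ) 2 ⊗[ℂ] H)

/-- The ampliation `I ⊗ a` on `ℓ₂ ⊗ H`: the continuous extension of `x ⊗ h ↦ x ⊗ a h`. -/
def ampliation {H : Type*} [NormedAddCommGroup H] [InnerProductSpace ℂ H] (a : H →L[ℂ] H) :
    EllTwoTensor H →L[ℂ] EllTwoTensor H :=
  ((UniformSpace.Completion.toComplL (𝕜 := ℂ)).comp
    (a.lTensor (lp (fun _ : ℕ => ℂ) 2))).extend (UniformSpace.Completion.toComplL (𝕜 := ℂ))

theorem ampliation_coe {H : Type*} [NormedAddCommGroup H] [InnerProductSpace ℂ H]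
    (a : H →L[ℂ] H) (z : lp (fun _ : ℕ => ℂ) 2 ⊗[ℂ] H) :
    ampliation a (z : EllTwoTensor H)
      = ((a.lTensor (lp (fun _ : ℕ => ℂ) 2) z : lp (fun _ : ℕ => ℂ) 2 ⊗[ℂ] H) :
          EllTwoTensor H) :=
  ContinuousLinearMap.extend_eq _ UniformSpace.Completion.denseRange_coe
    (UniformSpace.Completion.isUniformInducing_coe _) z

theorem ampliation_tmul {H : Type*} [NormedAddCommGroup H] [InnerProductSpace ℂ H]
    (a : H →L[ℂ] H) (x : lp (fun _ : ℕ => ℂ) 2) (h : H) :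
    ampliation a ((x ⊗ₜ[ℂ] h : lp (fun _ : ℕ => ℂ) 2 ⊗[ℂ] H) : EllTwoTensor H)
      = ((x ⊗ₜ[ℂ] a h : lp (fun _ : ℕ => ℂ) 2 ⊗[ℂ] H) : EllTwoTensor H) :=
  ampliation_coe a _

/-- The compression `P_E T|_E` of an operator `T` on a Hilbert space to a closed subspace `E`. -/
def compression {K : Type*} [NormedAddCommGroup K] [InnerProductSpace ℂ K] [CompleteSpace K]
    (E : ClosedSubmodule ℂ K) (T : K →L[ℂ] K) : E.toSubmodule →L[ℂ] E.toSubmodule :=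
  E.toSubmodule.orthogonalProjectionOnto ∘L T ∘L E.toSubmodule.subtypeL

/-- A `k × k` matrix of operators on `K`, as an operator on the Hilbert space `ℓ₂ᵏ(K)`:
`(T v) i = ∑ j, T i j (v j)`. -/
def matrixOp {K : Type*} [NormedAddCommGroup K] [InnerProductSpace ℂ K] {k : ℕ}
    (T : Matrix (Fin k) (Fin k) (K →L[ℂ] K)) :
    PiLp 2 (fun _ : Fin k => K) →L[ℂ] PiLp 2 (fun _ : Fin k => K) :=
  (PiLp.continuousLinearEquiv 2 ℂ (fun _ : Fin k => K)).symm.toContinuousLinearMap ∘L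
    ContinuousLinearMap.pi fun i => ∑ j, T i j ∘L PiLp.proj 2 (fun _ : Fin k => K) j

theorem matrixOp_apply {K : Type*} [NormedAddCommGroup K] [InnerProductSpace ℂ K] {k : ℕ}
    (T : Matrix (Fin k) (Fin k) (K →L[ℂ] K)) (v : PiLp 2 (fun _ : Fin k => K)) (i : Fin k) :
    matrixOp T v i = ∑ j, T i j (v j) := by
  simp [matrixOp]

/-- The norm of `M_k(A/J) = M_k(A)/M_k(J)`: the quotient norm, i.e. the infimum of the operator
norms on `ℓ₂ᵏ(H)` of the matrices over `A` that represent the given matrix of cosets. -/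
def quotientMatrixNorm {H : Type*} [NormedAddCommGroup H] [InnerProductSpace ℂ H]
    {A : Subalgebra ℂ (H →L[ℂ] H)} (J : Ideal A) {k : ℕ}
    (x : Matrix (Fin k) (Fin k) (A ⧸ J)) : ℝ :=
  sInf {r : ℝ | ∃ y : Matrix (Fin k) (Fin k) A,
    (∀ i j, (Submodule.Quotient.mk (y i j) : A ⧸ J) = x i j) ∧
      r = ‖matrixOp (y.map fun a => (a : H →L[ℂ] H))‖}

/-- A map `Ψ : A/J → B(K)` is completely isometric: for every `k`, the amplification
`M_k(A/J) → M_k(B(K)) = B(ℓ₂ᵏ(K))` preserves the norm. -/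
def IsCompletelyIsometric {H : Type*} [NormedAddCommGroup H] [InnerProductSpace ℂ H]
    {A : Subalgebra ℂ (H →L[ℂ] H)} (J : Ideal A)
    {K : Type*} [NormedAddCommGroup K] [InnerProductSpace ℂ K]
    (Ψ : A ⧸ J → (K →L[ℂ] K)) : Prop :=
  ∀ (k : ℕ) (x : Matrix (Fin k) (Fin k) (A ⧸ J)),
    ‖matrixOp (x.map Ψ)‖ = quotientMatrixNorm J x

end DualAlgebra

end

open scoped TensorProduct

noncomputable section

universe u

namespace DualAlgebra

/-! The quotient norm on `M_k(A/J)` is computed by duality, and the functionals that compute it are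
then realized by vectors of a single semi-invariant subspace of `ℓ₂ ⊗ H`.

Since `J` is weak-star closed, so is `M_k(J)` in `B(ℓ₂ᵏ(H))`. Every normal functional is a pairing
`T ↦ ∑ ⟪η n, T (ξ n)⟫`, so Hahn-Banach gives the distance formula `exists_norm_le_sub_mem`: the
distance from `x` to `M_k(J)` is attained, and is the least `r` with `|pairing ξ η x| ≤ r ‖ξ‖ ‖η‖`
for all pairs whose functional kills `M_k(J)`.

By separability, countably many such pairs, dense for every `k`, suffice. `exists_family` places
each pair in its own copy of `ℓ₂` inside `ℓ₂ ⊗ H`, the copies being mutually orthogonal and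
invariant under `I ⊗ a`. Let `v` collect the coordinates of all the `ξ`, and let `M` and `N` be the
closed spans of `(I ⊗ A)v` and `(I ⊗ J)v`. The `ξ` lie in `M` and the `η` are orthogonal to `N`.

Put `E = M ⊖ N`. As `M` and `N` are invariant and `J` maps `M` into `N`, compression to `E` is
multiplicative and kills `J`. It is completely contractive on `A`, hence on `A/J`. Conversely, by
`inner_compression` it preserves `⟪w, (I ⊗ a)u⟫` for `u ∈ M` and `w ⟂ N`, so it sees all the chosen
functionals and its norm is at least the distance to `M_k(J)`. -/

/-- The Hilbert sum of countably many copies of `K`. -/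
abbrev EllTwo (K : Type*) [NormedAddCommGroup K] : Type _ := lp (fun _ : ℕ => K) 2

/-! ### Countable Hilbert sums and mutually orthogonal copies of a sum inside itself -/

section EllTwo

theorem EllTwo.norm_sq_eq_tsum {K : Type*} [NormedAddCommGroup K] (ξ : EllTwo K) :
    ‖ξ‖ ^ 2 = ∑' n, ‖ξ n‖ ^ 2 := by
  have h := lp.norm_rpow_eq_tsum (p := 2) (by norm_num) ξ
  norm_num at h
  exact h

theorem EllTwo.summable_norm_sq {K : Type*} [NormedAddCommGroup K] (ξ : EllTwo K) :
    Summable fun n => ‖ξ n‖ ^ 2 := by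
  have h := (lp.memℓp ξ).summable (by norm_num)
  norm_num at h
  exact h

theorem hasSum_single {K : Type*} [NormedAddCommGroup K] (ξ : EllTwo K) :
    HasSum (fun n => lp.single 2 n (ξ n)) ξ :=
  lp.hasSum_single (by norm_num) ξ

variable {K K' : Type*} [NormedAddCommGroup K] [InnerProductSpace ℂ K]
  [NormedAddCommGroup K'] [InnerProductSpace ℂ K']

theorem EllTwo.sum_apply {K : Type*} [NormedAddCommGroup K] {ι : Type*} (s : Finset ι)
    (ξ : ι → EllTwo K) (n : ℕ) : (∑ i ∈ s, ξ i) n = ∑ i ∈ s, ξ i n := by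
  rw [lp.coeFn_sum]
  exact Finset.sum_apply n s _

theorem memℓp_map (T : K →L[ℂ] K') (ξ : EllTwo K) : Memℓp (fun n => T (ξ n)) 2 := by
  refine memℓp_gen ?_
  have h : Summable fun n => ‖T (ξ n)‖ ^ 2 :=
    Summable.of_nonneg_of_le (fun n => by positivity)
      (fun n => by
        rw [← mul_pow]
        exact pow_le_pow_left₀ (norm_nonneg _) (T.le_opNorm _) 2)
      ((EllTwo.summable_norm_sq ξ).mul_left (‖T‖ ^ 2))
  norm_num
  exact h

theorem norm_map_le (T : K →L[ℂ] K') (ξ : EllTwo K) :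
    ‖(⟨fun n => T (ξ n), memℓp_map T ξ⟩ : EllTwo K')‖ ≤ ‖T‖ * ‖ξ‖ := by
  refine abs_le_of_sq_le_sq' ?_ (by positivity) |>.2
  rw [mul_pow, EllTwo.norm_sq_eq_tsum, EllTwo.norm_sq_eq_tsum, ← tsum_mul_left]
  refine Summable.tsum_le_tsum (fun n => ?_) ?_ ((EllTwo.summable_norm_sq ξ).mul_left _)
  · rw [← mul_pow]
    exact pow_le_pow_left₀ (norm_nonneg _) (T.le_opNorm _) 2
  · exact EllTwo.summable_norm_sq (⟨fun n => T (ξ n), memℓp_map T ξ⟩ : EllTwo K')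

/-- The operator `T ⊕ T ⊕ ⋯` between Hilbert sums. -/
def lpMap (T : K →L[ℂ] K') : EllTwo K →L[ℂ] EllTwo K' :=
  LinearMap.mkContinuous
    { toFun := fun ξ => ⟨fun n => T (ξ n), memℓp_map T ξ⟩
      map_add' := fun ξ η => by ext n; exact map_add T (ξ n) (η n)
      map_smul' := fun c ξ => by ext n; exact map_smul T c (ξ n) }
    ‖T‖ (norm_map_le T)

theorem norm_lpMap_apply_le (T : K →L[ℂ] K') (ξ : EllTwo K) : ‖lpMap T ξ‖ ≤ ‖T‖ * ‖ξ‖ :=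
  norm_map_le T ξ

@[simp]
theorem lpMap_apply (T : K →L[ℂ] K') (ξ : EllTwo K) (n : ℕ) : lpMap T ξ n = T (ξ n) := rfl

@[simp]
theorem lpMap_single (T : K →L[ℂ] K') (n : ℕ) (x : K) :
    lpMap T (lp.single 2 n x) = lp.single 2 n (T x) := by
  ext m
  simp only [lpMap_apply, lp.single_apply]
  by_cases h : m = n
  · subst h; simp
  · simp [h]

/-- The inclusion of `K` as the `n`-th summand. -/
def inclusion (K : Type*) [NormedAddCommGroup K] [InnerProductSpace ℂ K] (n : ℕ) :
    K →ₗᵢ[ℂ] EllTwo K where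
  toFun x := lp.single 2 n x
  map_add' x y := lp.single_add (E := fun _ : ℕ => K) 2 n x y
  map_smul' c x := lp.single_smul (E := fun _ : ℕ => K) 2 n c x
  norm_map' x := lp.norm_single (E := fun _ : ℕ => K) two_pos n x

@[simp]
theorem inclusion_apply (n : ℕ) (x : K) : inclusion K n x = lp.single 2 n x := rfl

theorem orthogonalFamily_inclusion {f : ℕ → ℕ} (hf : Function.Injective f) :
    OrthogonalFamily ℂ (fun _ : ℕ => K) fun m => inclusion K (f m) := by
  intro i j hij x y
  simp only [inclusion_apply, lp.inner_single_left]
  rw [lp.single_apply_ne _ _ _ (hf.ne hij), inner_zero_right]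

theorem pair_right_injective (n : ℕ) : Function.Injective fun m => Nat.pair n m := fun a b h => by
  simpa using congrArg Nat.unpair h

variable [CompleteSpace K]

/-- The isometry sending the `m`-th summand to the summand with index `Nat.pair n m`. -/
def shift (n : ℕ) : EllTwo K →ₗᵢ[ℂ] EllTwo K :=
  (orthogonalFamily_inclusion (pair_right_injective n)).linearIsometry

theorem hasSum_shift (n : ℕ) (ξ : EllTwo K) :
    HasSum (fun m => lp.single 2 (Nat.pair n m) (ξ m)) (shift n ξ) :=
  (orthogonalFamily_inclusion (pair_right_injective n)).hasSum_linearIsometry ξ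

theorem lpMap_shift [CompleteSpace K'] (T : K →L[ℂ] K') (n : ℕ) (ξ : EllTwo K) :
    lpMap T (shift n ξ) = shift n (lpMap T ξ) := by
  have h := (hasSum_shift n ξ).mapL (lpMap T)
  simp only [lpMap_single] at h
  exact h.unique (hasSum_shift n (lpMap T ξ))

theorem shift_apply_of_ne {n m : ℕ} (h : n ≠ m) (l : ℕ) (ξ : EllTwo K) :
    shift n ξ (Nat.pair m l) = 0 := by
  have h1 := (hasSum_shift n ξ).mapL (lp.evalCLM (𝕜 := ℂ) (fun _ : ℕ => K) 2 (Nat.pair m l))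
  refine h1.unique ?_
  convert! hasSum_zero with k
  exact lp.single_apply_ne (E := fun _ : ℕ => K) 2 (Nat.pair n k) (ξ k) fun h2 =>
    h (Nat.pair_eq_pair.1 h2).1.symm

/-- `Nat.pair` splits `ℕ` into infinitely many infinite blocks, so distinct shifts have disjoint
supports. Together with `lpMap_shift` this gives orthogonal blocks that reduce every `lpMap T`. -/
theorem inner_shift_of_ne {n m : ℕ} (h : n ≠ m) (ξ η : EllTwo K) :
    inner ℂ (shift n ξ) (shift m η) = 0 := by
  have h1 := (hasSum_shift m η).mapL (innerSL ℂ (shift n ξ))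
  refine h1.unique ?_
  convert! hasSum_zero with k
  rw [innerSL_apply_apply, lp.inner_single_right, shift_apply_of_ne h, inner_zero_left]

end EllTwo

theorem separableSpace_ellTwo (K : Type*) [NormedAddCommGroup K] [InnerProductSpace ℂ K]
    [TopologicalSpace.SeparableSpace K] : TopologicalSpace.SeparableSpace (EllTwo K) := by
  have h : TopologicalSpace.IsSeparable
      (closure (Submodule.span ℂ (⋃ n, Set.range (inclusion K n)) : Set (EllTwo K))) := by
    refine (TopologicalSpace.IsSeparable.span ?_).closure
    exact .iUnion fun n => TopologicalSpace.isSeparable_range (inclusion K n).continuous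
  rw [← TopologicalSpace.isSeparable_univ_iff]
  refine h.mono fun ξ _ => ?_
  refine mem_closure_of_tendsto (hasSum_single ξ) (Filter.Eventually.of_forall fun s => ?_)
  refine Submodule.sum_mem _ fun n _ => Submodule.subset_span ?_
  exact Set.mem_iUnion.2 ⟨n, ξ n, rfl⟩

/-! ### Normal functionals and the distance formula for weak-star closed subspaces -/

section Predual

variable {K : Type*} [NormedAddCommGroup K] [InnerProductSpace ℂ K]

/-- The normal functional `T ↦ ∑ n, ⟪η n, T (ξ n)⟫`. -/
def pairing (ξ η : EllTwo K) : (K →L[ℂ] K) →ₗ[ℂ] ℂ where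
  toFun T := inner ℂ η (lpMap T ξ)
  map_add' S T := by
    rw [← inner_add_right]
    rfl
  map_smul' c T := by
    rw [RingHom.id_apply, smul_eq_mul, ← inner_smul_right]
    rfl

theorem pairing_apply (ξ η : EllTwo K) (T : K →L[ℂ] K) :
    pairing ξ η T = inner ℂ η (lpMap T ξ) := rfl

theorem pairing_apply_eq_tsum (ξ η : EllTwo K) (T : K →L[ℂ] K) :
    pairing ξ η T = ∑' n, inner ℂ (η n) (T (ξ n)) := rfl

theorem pairing_single_left (n : ℕ) (x : K) (η : EllTwo K) (T : K →L[ℂ] K) :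
    pairing (lp.single 2 n x) η T = inner ℂ (η n) (T x) := by
  rw [pairing_apply, lpMap_single, lp.inner_single_right]

theorem pairing_add_left (ξ ξ' η : EllTwo K) :
    pairing (ξ + ξ') η = pairing ξ η + pairing ξ' η := by
  ext T; simp [pairing_apply]

theorem pairing_add_right (ξ η η' : EllTwo K) :
    pairing ξ (η + η') = pairing ξ η + pairing ξ η' := by
  ext T; simp [pairing_apply]

theorem pairing_smul_left (z : ℂ) (ξ η : EllTwo K) :
    pairing (z • ξ) η = z • pairing ξ η := by
  ext T; simp [pairing_apply]

theorem pairing_smul_right (z : ℂ) (ξ η : EllTwo K) :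
    pairing ξ (z • η) = starRingEnd ℂ z • pairing ξ η := by
  ext T; simp [pairing_apply, mul_comm]

/-- The normal functional attached to a finite linear combination of pairs of sequences. -/
def normalFunctional (K : Type*) [NormedAddCommGroup K] [InnerProductSpace ℂ K] :
    ((EllTwo K × EllTwo K) →₀ ℂ) →ₗ[ℂ] Module.Dual ℂ (K →L[ℂ] K) :=
  Finsupp.linearCombination ℂ fun q => pairing q.1 q.2

theorem normalFunctional_single (q : EllTwo K × EllTwo K) (z : ℂ) :
    normalFunctional K (Finsupp.single q z) = z • pairing q.1 q.2 :=
  Finsupp.linearCombination_single ..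

/-- The projective seminorm `∑ |c (ξ, η)| ‖ξ‖ ‖η‖`. -/
def projSeminorm (K : Type*) [NormedAddCommGroup K] :
    Seminorm ℂ ((EllTwo K × EllTwo K) →₀ ℂ) :=
  Seminorm.of (fun c => c.sum fun q z => ‖z‖ * (‖q.1‖ * ‖q.2‖))
    (fun c d => by
      classical
      rw [Finsupp.sum_of_support_subset (c + d) Finsupp.support_add _ (by simp),
        Finsupp.sum_of_support_subset c Finset.subset_union_left _ (by simp),
        Finsupp.sum_of_support_subset d Finset.subset_union_right _ (by simp),
        ← Finset.sum_add_distrib]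
      refine Finset.sum_le_sum fun q _ => ?_
      rw [← add_mul]
      gcongr
      exact norm_add_le _ _)
    (fun a c => by
      rw [Finsupp.sum_of_support_subset (a • c) Finsupp.support_smul _ (by simp), Finsupp.sum,
        Finset.mul_sum]
      simp [mul_assoc])

theorem projSeminorm_apply {K : Type*} [NormedAddCommGroup K]
    (c : (EllTwo K × EllTwo K) →₀ ℂ) :
    projSeminorm K c = c.sum fun q z => ‖z‖ * (‖q.1‖ * ‖q.2‖) := rfl

theorem projSeminorm_single {K : Type*} [NormedAddCommGroup K]
    (q : EllTwo K × EllTwo K) (z : ℂ) :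
    projSeminorm K (Finsupp.single q z) = ‖z‖ * (‖q.1‖ * ‖q.2‖) := by
  rw [projSeminorm_apply, Finsupp.sum_single_index (by simp)]

/-- Rescaling `ξ` by `t` and `η` by the conjugate of `z / t` (the pairing is conjugate-linear in
`η`) multiplies the functional by `z`. The value of `t` makes both squared norms equal to `‖z‖ ‖ξ‖
‖η‖`. -/
theorem exists_pairing_eq_smul (ξ η : EllTwo K) (z : ℂ) :
    ∃ ξ' η' : EllTwo K, pairing ξ' η' = z • pairing ξ η ∧
      ‖ξ'‖ ^ 2 ≤ ‖z‖ * (‖ξ‖ * ‖η‖) ∧ ‖η'‖ ^ 2 ≤ ‖z‖ * (‖ξ‖ * ‖η‖) := by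
  by_cases h : z = 0 ∨ ξ = 0 ∨ η = 0
  · refine ⟨0, 0, ?_, by simpa using by positivity, by simpa using by positivity⟩
    ext T
    rcases h with h | h | h <;> simp [pairing_apply, h]
  · push Not at h
    obtain ⟨hz, hξ, hη⟩ := h
    have hz' := norm_pos_iff.2 hz
    have hξ' := norm_pos_iff.2 hξ
    have hη' := norm_pos_iff.2 hη
    set t : ℝ := Real.sqrt (‖z‖ * ‖η‖ / ‖ξ‖) with ht
    have htpos : 0 < t := Real.sqrt_pos.2 (by positivity)
    have htsq : t ^ 2 = ‖z‖ * ‖η‖ / ‖ξ‖ := Real.sq_sqrt (by positivity)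
    have htc : (t : ℂ) ≠ 0 := by exact_mod_cast htpos.ne'
    refine ⟨(t : ℂ) • ξ, (starRingEnd ℂ (z / t)) • η, ?_, ?_, ?_⟩
    · ext T
      simp only [pairing_apply, map_smul, inner_smul_left, inner_smul_right, Complex.conj_conj,
        LinearMap.smul_apply, smul_eq_mul]
      field_simp
    · rw [norm_smul, mul_pow, Complex.norm_real, Real.norm_eq_abs, sq_abs, htsq]
      apply le_of_eq
      field_simp
    · rw [norm_smul, mul_pow, RCLike.norm_conj, norm_div, div_pow, Complex.norm_real,
        Real.norm_eq_abs, sq_abs, htsq]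
      apply le_of_eq
      field_simp

/-- A basic neighbourhood of `y` that misses `S` involves finitely many pairings only, so the
separation takes place in the finite-dimensional space `I → ℂ`, where it is linear algebra. -/
theorem exists_normalFunctional_ne_zero {S : Submodule ℂ (K →L[ℂ] K)}
    (hS : IsWeakStarClosed (S : Set (K →L[ℂ] K))) {y : K →L[ℂ] K} (hy : y ∉ S) :
    ∃ c, (∀ T ∈ S, normalFunctional K c T = 0) ∧ normalFunctional K c y ≠ 0 := by
  classical
  obtain ⟨C, hC, hCS⟩ := isClosed_induced_iff.1 hS
  have hyC : (fun p : EllTwo K × EllTwo K => pairing p.1 p.2 y) ∈ Cᶜ := fun h => hy <| by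
    rw [← SetLike.mem_coe, ← hCS]
    exact h
  obtain ⟨I, u, hu, hIu⟩ := isOpen_pi_iff.1 hC.isOpen_compl _ hyC
  let F : (K →L[ℂ] K) →ₗ[ℂ] (I → ℂ) := LinearMap.pi fun q => pairing q.1.1 q.1.2
  have hF : F y ∉ S.map F := by
    rintro ⟨s, hs, hsy⟩
    have h1 : (fun p : EllTwo K × EllTwo K => pairing p.1 p.2 s) ∈ Cᶜ := by
      refine hIu fun q hq => ?_
      have h2 : pairing q.1 q.2 s = pairing q.1 q.2 y := congrFun hsy ⟨q, hq⟩
      simp only [h2]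
      exact (hu q hq).2
    refine h1 ?_
    rw [← hCS] at hs
    exact hs
  obtain ⟨g, hgy, hg⟩ := Submodule.exists_le_ker_of_notMem hF
  have key : ∀ T, normalFunctional K
      (∑ q : I, Finsupp.single (q : EllTwo K × EllTwo K) (g fun j => if q = j then 1 else 0)) T
        = g (F T) := by
    intro T
    rw [LinearMap.pi_apply_eq_sum_univ g (F T), map_sum, LinearMap.sum_apply]
    refine Finset.sum_congr rfl fun q _ => ?_
    rw [normalFunctional_single, LinearMap.smul_apply, smul_eq_mul, smul_eq_mul, mul_comm]
    rfl
  exact ⟨_, fun T hT => (key T).trans (hg ⟨T, hT, rfl⟩), (key y).trans_ne hgy⟩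

variable [CompleteSpace K]

theorem norm_shift_add_sq {n m : ℕ} (h : n ≠ m) (ξ η : EllTwo K) :
    ‖shift n ξ + shift m η‖ ^ 2 = ‖ξ‖ ^ 2 + ‖η‖ ^ 2 := by
  rw [sq, norm_add_sq_eq_norm_sq_add_norm_sq_of_inner_eq_zero _ _ (inner_shift_of_ne h ξ η),
    LinearIsometry.norm_map, LinearIsometry.norm_map, sq, sq]

theorem pairing_shift_add {n m : ℕ} (h : n ≠ m) (ξ₁ ξ₂ η₁ η₂ : EllTwo K) :
    pairing (shift n ξ₁ + shift m ξ₂) (shift n η₁ + shift m η₂)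
      = pairing ξ₁ η₁ + pairing ξ₂ η₂ := by
  ext T
  simp only [pairing_apply, map_add, lpMap_shift, inner_add_left, inner_add_right,
    inner_shift_of_ne h, inner_shift_of_ne h.symm, LinearIsometry.inner_map_map,
    LinearMap.add_apply]
  ring

/-- A sum of pairings becomes one pairing once its terms sit in orthogonal blocks. The squared norms
then add up, which is why the bounds are on squares. -/
theorem exists_pairing_eq_normalFunctional (c : (EllTwo K × EllTwo K) →₀ ℂ) :
    ∃ ξ η : EllTwo K, pairing ξ η = normalFunctional K c ∧
      ‖ξ‖ ^ 2 ≤ projSeminorm K c ∧ ‖η‖ ^ 2 ≤ projSeminorm K c := by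
  classical
  induction c using Finsupp.induction with
  | zero => exact ⟨0, 0, by ext T; simp [pairing_apply], by simp, by simp⟩
  | single_add q z c hq _ ih =>
    obtain ⟨ξ₁, η₁, h₁, hξ₁, hη₁⟩ := exists_pairing_eq_smul q.1 q.2 z
    obtain ⟨ξ₂, η₂, h₂, hξ₂, hη₂⟩ := ih
    have hp : projSeminorm K (Finsupp.single q z + c)
        = ‖z‖ * (‖q.1‖ * ‖q.2‖) + projSeminorm K c := by
      rw [← projSeminorm_single q z]
      simp only [projSeminorm_apply]
      refine Finsupp.sum_add_index_of_disjoint ?_ _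
      rw [Finset.disjoint_left]
      intro a ha hac
      have := Finset.mem_singleton.1 (Finsupp.support_single_subset ha)
      exact hq (this ▸ hac)
    refine ⟨shift 0 ξ₁ + shift 1 ξ₂, shift 0 η₁ + shift 1 η₂, ?_, ?_, ?_⟩
    · rw [pairing_shift_add zero_ne_one, h₁, h₂, map_add, normalFunctional_single]
    · rw [norm_shift_add_sq zero_ne_one, hp]
      exact add_le_add hξ₁ hξ₂
    · rw [norm_shift_add_sq zero_ne_one, hp]
      exact add_le_add hη₁ hη₂

/-- A functional on the predual that is bounded by `r` times the projective seminorm is given by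
an operator of norm at most `r`. -/
theorem exists_operator_of_le_projSeminorm {r : ℝ} (hr : 0 ≤ r)
    (g : ((EllTwo K × EllTwo K) →₀ ℂ) →ₗ[ℂ] ℂ) (hg : ∀ c, ‖g c‖ ≤ r * projSeminorm K c)
    (hg0 : ∀ c, normalFunctional K c = 0 → g c = 0) :
    ∃ x : K →L[ℂ] K, ‖x‖ ≤ r ∧ ∀ c, g c = normalFunctional K c x := by
  have hcongr : ∀ c d, normalFunctional K c = normalFunctional K d → g c = g d := fun c d h => by
    rw [← sub_eq_zero, ← map_sub]
    exact hg0 _ (by rw [map_sub, h, sub_self])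
  -- By `hg0`, `g` depends only on the normal functional of its argument, and this makes the form
  -- sesquilinear.
  let B₀ : EllTwo K →ₗ⋆[ℂ] EllTwo K →ₗ[ℂ] ℂ :=
    LinearMap.mk₂'ₛₗ (starRingEnd ℂ) (RingHom.id ℂ) (fun η ξ => g (Finsupp.single (ξ, η) 1))
      (fun η η' ξ => by
        rw [← map_add]
        exact hcongr _ _ (by simp [normalFunctional_single, pairing_add_right]))
      (fun z η ξ => by
        rw [← map_smul]
        exact hcongr _ _ (by simp only [normalFunctional_single, pairing_smul_right, map_smul]
                             simp))
      (fun η ξ ξ' => by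
        rw [← map_add]
        exact hcongr _ _ (by simp [normalFunctional_single, pairing_add_left]))
      (fun z η ξ => by
        rw [← map_smul]
        exact hcongr _ _ (by simp only [normalFunctional_single, pairing_smul_left, map_smul]
                             simp))
  have hB₀ : ∀ η ξ, ‖B₀ η ξ‖ ≤ r * ‖η‖ * ‖ξ‖ := fun η ξ => by
    refine (hg _).trans (le_of_eq ?_)
    rw [projSeminorm_single, norm_one]
    ring
  let B : EllTwo K →L⋆[ℂ] EllTwo K →L[ℂ] ℂ := B₀.mkContinuous₂ r hB₀
  have hB : ∀ η ξ, B η ξ = g (Finsupp.single (ξ, η) 1) := fun η ξ => rfl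
  have hbound : ∀ η ξ : K, ‖B (inclusion K 0 η) (inclusion K 0 ξ)‖ ≤ r * ‖η‖ * ‖ξ‖ :=
    fun η ξ => by
      have h1 := hB₀ (inclusion K 0 η) (inclusion K 0 ξ)
      rw [LinearIsometry.norm_map, LinearIsometry.norm_map] at h1
      exact h1
  let ι : K →L[ℂ] EllTwo K := (inclusion K 0).toContinuousLinearMap
  -- The operator is read off from `B` on the zeroth summand alone.
  let x : K →L[ℂ] K := ContinuousLinearMap.adjoint ι ∘L
    ContinuousLinearMap.adjoint (InnerProductSpace.continuousLinearMapOfBilin B) ∘L ι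
  have hx : ∀ η ξ, inner ℂ η (x ξ) = B (inclusion K 0 η) (inclusion K 0 ξ) := fun η ξ => by
    rw [ContinuousLinearMap.comp_apply, ContinuousLinearMap.adjoint_inner_right,
      ContinuousLinearMap.comp_apply, ContinuousLinearMap.adjoint_inner_right,
      InnerProductSpace.continuousLinearMapOfBilin_apply]
    rfl
  refine ⟨x, ?_, ?_⟩
  · refine ContinuousLinearMap.opNorm_le_bound _ hr fun ξ => ?_
    by_cases h0 : x ξ = 0
    · rw [h0, norm_zero]; positivity
    · have h1 : ‖x ξ‖ * ‖x ξ‖ ≤ r * ‖x ξ‖ * ‖ξ‖ := by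
        refine le_trans (le_of_eq ?_) (hbound (x ξ) ξ)
        rw [← hx, inner_self_eq_norm_sq_to_K]
        simp [sq]
      have h2 := norm_pos_iff.2 h0
      nlinarith
  -- `B η` is continuous, so `ξ` may be expanded in its coordinates. The `n`-th term gives the
  -- functional `T ↦ ⟪η n, T (ξ n)⟫`, which is also the one given by `ξ n` and `η n` placed in the
  -- zeroth summand.
  · have hpair : ∀ ξ η, B η ξ = pairing ξ η x := fun ξ η => by
      have h1 := (hasSum_single ξ).mapL (B η)
      refine h1.unique ?_
      have h2 := lp.hasSum_inner (𝕜 := ℂ) η (lpMap x ξ)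
      convert! h2 using 2 with n
      rw [lpMap_apply, hx, hB, hB]
      refine hcongr _ _ ?_
      ext T
      simp only [normalFunctional_single, inclusion_apply, one_smul, pairing_single_left,
        lp.single_apply_self]
    intro c
    induction c using Finsupp.induction_linear with
    | zero => simp
    | add c d hc hd => simp [hc, hd]
    | single q z =>
      rw [normalFunctional_single, LinearMap.smul_apply, ← hpair, hB, ← map_smul]
      simp

/-- The distance formula in a dual space: an operator that is bounded by `r` on the
preannihilator of a weak-star closed subspace has a representative of norm at most `r`. -/
theorem exists_norm_le_sub_mem {S : Submodule ℂ (K →L[ℂ] K)}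
    (hS : IsWeakStarClosed (S : Set (K →L[ℂ] K))) (x : K →L[ℂ] K) {r : ℝ} (hr : 0 ≤ r)
    (h : ∀ ξ η, (∀ T ∈ S, pairing ξ η T = 0) → ‖pairing ξ η x‖ ≤ r * (‖ξ‖ * ‖η‖)) :
    ∃ x' : K →L[ℂ] K, ‖x'‖ ≤ r ∧ x' - x ∈ S := by
  let N : Submodule ℂ ((EllTwo K × EllTwo K) →₀ ℂ) :=
    S.dualAnnihilator.comap (normalFunctional K)
  have hN : ∀ c, c ∈ N ↔ ∀ T ∈ S, normalFunctional K c T = 0 := fun c => by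
    rw [Submodule.mem_comap, Submodule.mem_dualAnnihilator]
  let f₀ : ((EllTwo K × EllTwo K) →₀ ℂ) →ₗ[ℂ] ℂ := LinearMap.applyₗ x ∘ₗ normalFunctional K
  have hf₀ : ∀ c, f₀ c = normalFunctional K c x := fun c => rfl
  let r' : NNReal := ⟨r, hr⟩
  have hf : ∀ c : N, ‖f₀.domRestrict N c‖ ≤ (r' • projSeminorm K) c := by
    rintro ⟨c, hc⟩
    obtain ⟨ξ, η, hc', hξ, hη⟩ := exists_pairing_eq_normalFunctional c
    rw [hN, ← hc'] at hc
    rw [LinearMap.domRestrict_apply, hf₀, ← hc']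
    refine (h ξ η hc).trans ?_
    refine mul_le_mul_of_nonneg_left ?_ hr
    -- `‖ξ‖ ‖η‖` is at most the mean of the two squares, each bounded by the seminorm.
    nlinarith [sq_nonneg (‖ξ‖ - ‖η‖)]
  obtain ⟨g, hgf, hg⟩ := Module.Dual.exists_extension_of_le_seminorm N (f₀.domRestrict N) hf
  have hgN : ∀ c ∈ N, g c = normalFunctional K c x := fun c hc => hgf ⟨c, hc⟩
  -- A combination with zero normal functional lies in `N`, where `g` is evaluation at `x`; so the
  -- extension `g` still factors through the normal functionals.
  obtain ⟨x', hx', hgx'⟩ := exists_operator_of_le_projSeminorm hr g (fun c => hg c) fun c hc => by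
    rw [hgN c ((hN c).2 fun T _ => by rw [hc]; rfl), hc]
    rfl
  refine ⟨x', hx', by_contra fun hmem => ?_⟩
  obtain ⟨c, hcS, hc⟩ := exists_normalFunctional_ne_zero hS hmem
  refine hc ?_
  rw [map_sub, ← hgx', hgN c ((hN c).2 hcS), sub_self]

end Predual

/-! ### Identification of `ℓ₂ ⊗ H` with the Hilbert sum of copies of `H` -/

section Ampliation

variable {H : Type*} [NormedAddCommGroup H] [InnerProductSpace ℂ H]

/-- The isometry `h ↦ e_n ⊗ h`. -/
def tensorInclusion (H : Type*) [NormedAddCommGroup H] [InnerProductSpace ℂ H] (n : ℕ) :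
    H →ₗᵢ[ℂ] EllTwoTensor H where
  toLinearMap := ((UniformSpace.Completion.toComplL (𝕜 := ℂ)).comp
    (TensorProduct.mkL ℂ (EllTwo ℂ) H (lp.single 2 n 1))).toLinearMap
  norm_map' h := by
    change ‖((lp.single 2 n 1 ⊗ₜ[ℂ] h : EllTwo ℂ ⊗[ℂ] H) : EllTwoTensor H)‖ = ‖h‖
    rw [UniformSpace.Completion.norm_coe, TensorProduct.norm_tmul, lp.norm_single (by norm_num)]
    simp

theorem tensorInclusion_apply (n : ℕ) (h : H) :
    tensorInclusion H n h
      = ((lp.single 2 n 1 ⊗ₜ[ℂ] h : EllTwo ℂ ⊗[ℂ] H) : EllTwoTensor H) := rfl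

theorem orthogonalFamily_tensorInclusion :
    OrthogonalFamily ℂ (fun _ : ℕ => H) (tensorInclusion H) := by
  intro i j hij x y
  rw [tensorInclusion_apply, tensorInclusion_apply, UniformSpace.Completion.inner_coe,
    TensorProduct.inner_tmul, lp.inner_single_left, lp.single_apply_ne _ _ _ hij]
  simp

/-- The isometry `ξ ↦ ∑ n, e_n ⊗ ξ n` from the Hilbert sum onto `ℓ₂ ⊗ H`. -/
def toTensor (H : Type*) [NormedAddCommGroup H] [InnerProductSpace ℂ H] :
    EllTwo H →ₗᵢ[ℂ] EllTwoTensor H :=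
  orthogonalFamily_tensorInclusion.linearIsometry

theorem hasSum_toTensor (ξ : EllTwo H) :
    HasSum (fun n => tensorInclusion H n (ξ n)) (toTensor H ξ) :=
  orthogonalFamily_tensorInclusion.hasSum_linearIsometry ξ

theorem toTensor_single (n : ℕ) (h : H) :
    toTensor H (lp.single 2 n h) = tensorInclusion H n h :=
  orthogonalFamily_tensorInclusion.linearIsometry_apply_single h

theorem ampliation_toTensor (a : H →L[ℂ] H) (ξ : EllTwo H) :
    ampliation a (toTensor H ξ) = toTensor H (lpMap a ξ) := by
  have h := (hasSum_toTensor ξ).mapL (ampliation a)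
  simp only [tensorInclusion_apply, ampliation_tmul] at h
  exact h.unique (hasSum_toTensor (lpMap a ξ))

/-- The range of an isometry on a complete space is closed, and it contains each `x ⊗ h` as the
limit of the partial sums of `∑ e_n ⊗ (x n • h)`. -/
theorem toTensor_surjective [CompleteSpace H] : Function.Surjective (toTensor H) := by
  have hclosed : IsClosed (LinearMap.range (toTensor H).toLinearMap : Set (EllTwoTensor H)) :=
    (toTensor H).isometry.isUniformInducing.isComplete_range.isClosed
  intro z
  change z ∈ (LinearMap.range (toTensor H).toLinearMap : Set (EllTwoTensor H))
  induction z using UniformSpace.Completion.induction_on with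
  | hp => exact hclosed
  | ih z =>
    induction z using TensorProduct.induction_on with
    | zero =>
      rw [UniformSpace.Completion.coe_zero]
      exact Submodule.zero_mem _
    | add x y hx hy =>
      rw [UniformSpace.Completion.coe_add]
      exact Submodule.add_mem _ hx hy
    | tmul x h =>
      have hs := (hasSum_single x).mapL ((UniformSpace.Completion.toComplL (𝕜 := ℂ)).comp
        ((TensorProduct.mkL ℂ (EllTwo ℂ) H).flip h))
      refine hclosed.mem_of_tendsto hs (Filter.Eventually.of_forall fun s => ?_)
      refine Submodule.sum_mem _ fun n _ => ?_
      refine ⟨lp.single 2 n (x n • h), ?_⟩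
      change toTensor H _ = _
      rw [toTensor_single, map_smul, tensorInclusion_apply, ← UniformSpace.Completion.coe_smul,
        TensorProduct.smul_tmul', ← lp.single_smul, smul_eq_mul, mul_one]
      rfl

variable [CompleteSpace H]

theorem ampliation_ext {S T : EllTwoTensor H →L[ℂ] EllTwoTensor H}
    (h : ∀ ξ, S (toTensor H ξ) = T (toTensor H ξ)) : S = T := by
  ext z
  obtain ⟨ξ, rfl⟩ := toTensor_surjective z
  exact h ξ

/-- The ampliation as a homomorphism of algebras. -/
def ampliationHom (H : Type*) [NormedAddCommGroup H] [InnerProductSpace ℂ H] [CompleteSpace H] :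
    (H →L[ℂ] H) →ₐ[ℂ] (EllTwoTensor H →L[ℂ] EllTwoTensor H) :=
  AlgHom.ofLinearMap
    { toFun := ampliation
      map_add' := fun a b => ampliation_ext fun ξ => by
        rw [add_apply]
        simp only [ampliation_toTensor]
        rw [← map_add]
        rfl
      map_smul' := fun c a => ampliation_ext fun ξ => by
        rw [smul_apply]
        simp only [ampliation_toTensor]
        rw [← map_smul]
        rfl }
    (ampliation_ext fun ξ => ampliation_toTensor 1 ξ)
    (fun a b => ampliation_ext fun ξ => by
      change ampliation _ _ = ampliation _ (ampliation _ _)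
      simp only [ampliation_toTensor]
      rfl)

end Ampliation

/-! ### Compression to a semi-invariant subspace -/

section SemiInvariant

variable {A : Type*} [Ring A] [Algebra ℂ A]
  {K : Type*} [NormedAddCommGroup K] [InnerProductSpace ℂ K]
  {ι : Type*}

/-- The closed span of the vectors `π a (v s)` with `a ∈ I`. -/
def orbit (π : A →ₐ[ℂ] (K →L[ℂ] K)) (I : Ideal A) (v : ι → K) : ClosedSubmodule ℂ K :=
  (Submodule.span ℂ {w | ∃ a ∈ I, ∃ s, w = π a (v s)}).closure

variable (π : A →ₐ[ℂ] (K →L[ℂ] K)) (J : Ideal A) (v : ι → K)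

theorem orbit_le {I : Ideal A} {E : ClosedSubmodule ℂ K}
    (h : ∀ a ∈ I, ∀ s, π a (v s) ∈ E) : orbit π I v ≤ E := by
  rw [orbit, Submodule.closure_le, Submodule.span_le]
  rintro _ ⟨a, ha, s, rfl⟩
  exact h a ha s

variable {v} in
theorem mem_orbit {I : Ideal A} {a : A} (ha : a ∈ I) (s : ι) : π a (v s) ∈ orbit π I v :=
  subset_closure (Submodule.subset_span ⟨a, ha, s, rfl⟩)

variable {π v} in
theorem map_mem_orbit {I I' : Ideal A} {a : A} (h : ∀ b ∈ I, a * b ∈ I') {w : K}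
    (hw : w ∈ orbit π I v) : π a w ∈ orbit π I' v := by
  have hle : orbit π I v ≤ (orbit π I' v).comap (π a) := orbit_le π v fun b hb s => by
    rw [ClosedSubmodule.mem_comap, ← mul_apply_eq_comp, ← map_mul]
    exact mem_orbit π (h b hb) s
  exact hle hw

/-- The difference of the invariant subspaces generated by a family of vectors under an algebra
and under an ideal. -/
def semiInvariant : ClosedSubmodule ℂ K := orbit π ⊤ v ⊓ (orbit π J v)ᗮ

variable [CompleteSpace K]

variable {π J v} in
theorem projection_eq_zero {w : K} (hw : w ∈ orbit π J v) :
    (semiInvariant π J v).toSubmodule.orthogonalProjectionOnto w = 0 := by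
  rw [Submodule.orthogonalProjectionOnto_eq_zero_iff, Submodule.mem_orthogonal]
  intro u hu
  exact inner_eq_zero_symm.1 (hu.2 w hw)

variable {π J v} in
-- With `M = orbit π ⊤ v`, `N = orbit π J v` and `E = M ⊖ N`, one has `M = N ⊕ E`; hence on `M` the
-- projection to `E` removes exactly the component in `N`.
theorem sub_projection_mem {w : K} (hw : w ∈ orbit π ⊤ v) :
    w - (semiInvariant π J v).toSubmodule.orthogonalProjectionOnto w ∈ orbit π J v := by
  set N := orbit π J v with hN
  have hNM : N ≤ orbit π ⊤ v := orbit_le π v fun a _ s => mem_orbit π (Submodule.mem_top) s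
  set n : K := N.toSubmodule.starProjection w with hn
  have hnN : n ∈ N := N.toSubmodule.starProjection_apply_mem w
  have he : w - n ∈ semiInvariant π J v := by
    refine ⟨sub_mem hw (hNM hnN), ?_⟩
    exact Submodule.sub_starProjection_mem_orthogonal w
  have h1 : (semiInvariant π J v).toSubmodule.orthogonalProjectionOnto w
      = (semiInvariant π J v).toSubmodule.orthogonalProjectionOnto (w - n) := by
    rw [map_sub, projection_eq_zero hnN, sub_zero]
  have h2 : (((semiInvariant π J v).toSubmodule.orthogonalProjectionOnto (w - n) :
      (semiInvariant π J v).toSubmodule) : K) = w - n :=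
    Submodule.starProjection_eq_self_iff.2 he
  rw [h1, h2, sub_sub_cancel]
  exact hnN

theorem compression_apply (E : ClosedSubmodule ℂ K) (T : K →L[ℂ] K) (e : E.toSubmodule) :
    compression E T e = E.toSubmodule.orthogonalProjectionOnto (T e) := rfl

/-- This is the source of multiplicativity: replacing `w` by its projection changes it by an element
of `N`, and `N` is invariant under `π a` and killed by the projection. -/
theorem projection_map_projection [J.IsTwoSided] (a : A) {w : K} (hw : w ∈ orbit π ⊤ v) :
    (semiInvariant π J v).toSubmodule.orthogonalProjectionOnto
        (π a ((semiInvariant π J v).toSubmodule.orthogonalProjectionOnto w))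
      = (semiInvariant π J v).toSubmodule.orthogonalProjectionOnto (π a w) := by
  have h := map_mem_orbit (a := a) (I' := J) (fun b hb => J.mul_mem_left a hb)
    (sub_projection_mem (J := J) hw)
  have h1 := projection_eq_zero h
  rw [map_sub, map_sub, sub_eq_zero] at h1
  exact h1.symm

/-- The compression of a representation to a semi-invariant subspace. -/
def compressionHom [J.IsTwoSided] :
    A →ₐ[ℂ] ((semiInvariant π J v).toSubmodule →L[ℂ] (semiInvariant π J v).toSubmodule) :=
  AlgHom.ofLinearMap
    { toFun := fun a => compression (semiInvariant π J v) (π a)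
      map_add' := fun a b => by
        ext e
        simp [compression]
      map_smul' := fun c a => by
        ext e
        simp [compression] }
    (by
      ext e
      simp [compression])
    (fun a b => by
      ext1 e
      have he : π b e ∈ orbit π ⊤ v := map_mem_orbit (fun _ _ => Submodule.mem_top) e.2.1
      change compression _ _ e = compression _ _ (compression _ _ e)
      simp only [compression_apply]
      rw [projection_map_projection π J v a he, map_mul]
      rfl)

theorem compressionHom_apply [J.IsTwoSided] (a : A) :
    compressionHom π J v a = compression (semiInvariant π J v) (π a) := rfl

theorem compressionHom_eq_zero [J.IsTwoSided] {a : A} (ha : a ∈ J) :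
    compressionHom π J v a = 0 := by
  ext1 e
  have he : π a e ∈ orbit π J v :=
    map_mem_orbit (I := ⊤) (fun b _ => J.mul_mem_right b ha) e.2.1
  rw [compressionHom_apply, compression_apply, projection_eq_zero he]
  rfl

variable {π J v} in
-- Projecting `u` and `π a u` to `E` changes them only by elements of `N`; the first change is
-- invisible to the compression, the second to `w`.
theorem inner_compression [J.IsTwoSided] (a : A) {u w : K} (hu : u ∈ orbit π ⊤ v)
    (hw : w ∈ (orbit π J v)ᗮ) :
    inner ℂ ((semiInvariant π J v).toSubmodule.orthogonalProjectionOnto w)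
        (compression (semiInvariant π J v) (π a)
          ((semiInvariant π J v).toSubmodule.orthogonalProjectionOnto u))
      = inner ℂ w (π a u) := by
  rw [compression_apply, projection_map_projection π J v a hu,
    Submodule.inner_orthogonalProjectionOnto_eq_of_mem_right, eq_comm, ← sub_eq_zero,
    ← inner_sub_right]
  have hau : π a u ∈ orbit π ⊤ v := map_mem_orbit (fun _ _ => Submodule.mem_top) hu
  exact inner_eq_zero_symm.1 (hw _ (sub_projection_mem hau))

end SemiInvariant

/-! ### Norms of matrices of compressions -/

section Matrix

variable {K : Type*} [NormedAddCommGroup K] [InnerProductSpace ℂ K] {k : ℕ}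

theorem inner_matrixOp (T : Matrix (Fin k) (Fin k) (K →L[ℂ] K))
    (v w : PiLp 2 fun _ : Fin k => K) :
    inner ℂ w (matrixOp T v) = ∑ i, ∑ j, inner ℂ (w i) (T i j (v j)) := by
  simp [PiLp.inner_apply, matrixOp_apply, inner_sum]

variable [CompleteSpace K]

theorem norm_projection_le (E : ClosedSubmodule ℂ K) (v : PiLp 2 fun _ : Fin k => K) :
    ‖(WithLp.toLp 2 fun i => E.toSubmodule.orthogonalProjectionOnto (v i) :
      PiLp 2 fun _ : Fin k => E.toSubmodule)‖ ≤ ‖v‖ := by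
  rw [PiLp.norm_eq_of_L2, PiLp.norm_eq_of_L2]
  refine Real.sqrt_le_sqrt (Finset.sum_le_sum fun i _ => ?_)
  exact pow_le_pow_left₀ (norm_nonneg _)
    (Submodule.norm_orthogonalProjectionOnto_apply_le E.toSubmodule (v i)) 2

theorem norm_matrixOp_compression_le (E : ClosedSubmodule ℂ K)
    (T : Matrix (Fin k) (Fin k) (K →L[ℂ] K)) :
    ‖matrixOp (T.map (compression E))‖ ≤ ‖matrixOp T‖ := by
  refine ContinuousLinearMap.opNorm_le_bound _ (norm_nonneg _) fun e => ?_
  have h1 : matrixOp (T.map (compression E)) e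
      = WithLp.toLp 2 fun i => E.toSubmodule.orthogonalProjectionOnto
        (matrixOp T (WithLp.toLp 2 fun j => (e j : K)) i) := by
    ext i
    simp [matrixOp_apply, compression_apply]
  have h2 : ‖(WithLp.toLp 2 fun j => (e j : K) : PiLp 2 fun _ : Fin k => K)‖ = ‖e‖ := by
    rw [PiLp.norm_eq_of_L2, PiLp.norm_eq_of_L2]
    rfl
  rw [h1, ← h2]
  exact (norm_projection_le E _).trans (ContinuousLinearMap.le_opNorm _ _)

theorem norm_inner_matrixOp_le {A : Type*} [Ring A] [Algebra ℂ A] {ι : Type*}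
    (π : A →ₐ[ℂ] (K →L[ℂ] K)) (J : Ideal A) [J.IsTwoSided] (v : ι → K)
    (x : Matrix (Fin k) (Fin k) A) {u w : PiLp 2 fun _ : Fin k => K}
    (hu : ∀ j, u j ∈ orbit π ⊤ v) (hw : ∀ i, w i ∈ (orbit π J v)ᗮ) :
    ‖inner ℂ w (matrixOp (x.map π) u)‖
      ≤ ‖matrixOp (x.map (compressionHom π J v))‖ * (‖u‖ * ‖w‖) := by
  set E := semiInvariant π J v with hE
  have h1 : inner ℂ w (matrixOp (x.map π) u)
      = inner ℂ (WithLp.toLp 2 fun i => E.toSubmodule.orthogonalProjectionOnto (w i) :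
          PiLp 2 fun _ : Fin k => E.toSubmodule)
        (matrixOp (x.map (compressionHom π J v))
          (WithLp.toLp 2 fun i => E.toSubmodule.orthogonalProjectionOnto (u i))) := by
    rw [inner_matrixOp, inner_matrixOp]
    refine Finset.sum_congr rfl fun i _ => Finset.sum_congr rfl fun j _ => ?_
    exact (inner_compression (x i j) (hu j) (hw i)).symm
  rw [h1]
  refine (norm_inner_le_norm _ _).trans ?_
  calc _ ≤ ‖w‖ * (‖matrixOp (x.map (compressionHom π J v))‖ * ‖u‖) := by
        refine mul_le_mul (norm_projection_le E w) ?_ (norm_nonneg _) (norm_nonneg _)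
        refine (ContinuousLinearMap.le_opNorm _ _).trans ?_
        exact mul_le_mul_of_nonneg_left (norm_projection_le E u) (norm_nonneg _)
    _ = _ := by ring

end Matrix

/-! ### Matrices over `B(H)` and their ampliations -/

section MatrixAmpliation

variable {H : Type*} [NormedAddCommGroup H] [InnerProductSpace ℂ H] {k : ℕ}

/-- The inclusion of `H` as the `j`-th summand of `ℓ₂ᵏ(H)`. -/
def coordInclusion (H : Type*) [NormedAddCommGroup H] [InnerProductSpace ℂ H] (j : Fin k) :
    H →L[ℂ] PiLp 2 (fun _ : Fin k => H) :=
  (PiLp.continuousLinearEquiv 2 ℂ (fun _ : Fin k => H)).symm.toContinuousLinearMap ∘L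
    ContinuousLinearMap.single ℂ (fun _ : Fin k => H) j

theorem coordInclusion_apply (i j : Fin k) (h : H) :
    coordInclusion H j h i = if i = j then h else 0 := by
  simp [coordInclusion]

theorem sum_coordInclusion (v : PiLp 2 (fun _ : Fin k => H)) :
    ∑ j, coordInclusion H j (v j) = v := by
  ext i
  simp [coordInclusion_apply]

/-- The `(i, j)` entry of an operator on `ℓ₂ᵏ(H)`. -/
def entry (i j : Fin k) :
    (PiLp 2 (fun _ : Fin k => H) →L[ℂ] PiLp 2 (fun _ : Fin k => H)) →ₗ[ℂ] (H →L[ℂ] H) where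
  toFun T := PiLp.proj 2 (fun _ : Fin k => H) i ∘L T ∘L coordInclusion H j
  map_add' S T := by ext; simp
  map_smul' c T := by ext; simp

theorem entry_apply (i j : Fin k)
    (T : PiLp 2 (fun _ : Fin k => H) →L[ℂ] PiLp 2 (fun _ : Fin k => H)) (h : H) :
    entry i j T h = T (coordInclusion H j h) i := rfl

theorem matrixOp_entry (T : PiLp 2 (fun _ : Fin k => H) →L[ℂ] PiLp 2 (fun _ : Fin k => H)) :
    matrixOp (Matrix.of fun i j => entry i j T) = T := by
  ext v i
  rw [matrixOp_apply]
  conv_rhs => rw [← sum_coordInclusion v, map_sum]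
  simp [entry_apply]

theorem entry_matrixOp (T : Matrix (Fin k) (Fin k) (H →L[ℂ] H)) (i j : Fin k) :
    entry i j (matrixOp T) = T i j := by
  ext h
  simp [entry_apply, matrixOp_apply, coordInclusion_apply, apply_ite]

theorem pairing_coordInclusion (ξ η : EllTwo H) (i j : Fin k)
    (T : PiLp 2 (fun _ : Fin k => H) →L[ℂ] PiLp 2 (fun _ : Fin k => H)) :
    pairing (lpMap (coordInclusion H j) ξ) (lpMap (coordInclusion H i) η) T
      = pairing ξ η (entry i j T) := by
  rw [pairing_apply_eq_tsum, pairing_apply_eq_tsum]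
  refine tsum_congr fun n => ?_
  rw [PiLp.inner_apply, Finset.sum_eq_single i]
  · simp [coordInclusion_apply, entry_apply]
  · intro l _ hl
    simp [coordInclusion_apply, hl]
  · simp

/-- A normal functional of an entry is a normal functional of the whole matrix, by
`pairing_coordInclusion`. This carries weak-star closedness from `J` to `M_k(J)`. -/
theorem continuous_entry (i j : Fin k) :
    @Continuous _ _ (weakStar (PiLp 2 (fun _ : Fin k => H))) (weakStar H) (entry (H := H) i j) := by
  refine continuous_induced_rng.2 ?_
  refine @continuous_pi _ _ _ (weakStar _) _ _ fun p => ?_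
  have h : ∀ T, (∑' n, inner ℂ (p.2 n) (entry i j T (p.1 n)))
      = ∑' n, inner ℂ (lpMap (coordInclusion H i) p.2 n) (T (lpMap (coordInclusion H j) p.1 n)) :=
    fun T => (pairing_coordInclusion p.1 p.2 i j T).symm
  refine @Continuous.congr _ _ (weakStar _) _ _ _ ?_ fun T => (h T).symm
  let q : EllTwo (PiLp 2 (fun _ : Fin k => H)) × EllTwo (PiLp 2 (fun _ : Fin k => H)) :=
    (lpMap (coordInclusion H j) p.1, lpMap (coordInclusion H i) p.2)
  have hq : Continuous fun f : EllTwo (PiLp 2 (fun _ : Fin k => H)) ×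
      EllTwo (PiLp 2 (fun _ : Fin k => H)) → ℂ => f q := continuous_apply q
  exact @Continuous.comp _ _ _ (weakStar _) _ _ _ _ hq continuous_induced_dom

/-- The operators on `ℓ₂ᵏ(H)` with entries in a given subspace of `B(H)`. -/
def matrixSubmodule (S : Submodule ℂ (H →L[ℂ] H)) (k : ℕ) :
    Submodule ℂ (PiLp 2 (fun _ : Fin k => H) →L[ℂ] PiLp 2 (fun _ : Fin k => H)) :=
  ⨅ i, ⨅ j, S.comap (entry i j)

theorem mem_matrixSubmodule {S : Submodule ℂ (H →L[ℂ] H)}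
    {T : PiLp 2 (fun _ : Fin k => H) →L[ℂ] PiLp 2 (fun _ : Fin k => H)} :
    T ∈ matrixSubmodule S k ↔ ∀ i j, entry i j T ∈ S := by
  simp [matrixSubmodule]

theorem isWeakStarClosed_matrixSubmodule {S : Submodule ℂ (H →L[ℂ] H)}
    (hS : IsWeakStarClosed (S : Set (H →L[ℂ] H))) (k : ℕ) :
    IsWeakStarClosed (matrixSubmodule S k : Set (PiLp 2 (fun _ : Fin k => H) →L[ℂ] _)) := by
  have h : (matrixSubmodule S k : Set (PiLp 2 (fun _ : Fin k => H) →L[ℂ] _))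
      = ⋂ i, ⋂ j, entry i j ⁻¹' (S : Set (H →L[ℂ] H)) := by
    ext T
    simp [mem_matrixSubmodule]
  rw [h]
  let := weakStar (PiLp 2 (fun _ : Fin k => H))
  let := weakStar H
  exact isClosed_iInter fun i => isClosed_iInter fun j => hS.preimage (continuous_entry i j)

theorem norm_sq_eq_sum_lpMap_proj (ζ : EllTwo (PiLp 2 (fun _ : Fin k => H))) :
    ‖ζ‖ ^ 2 = ∑ j, ‖lpMap (PiLp.proj 2 (fun _ : Fin k => H) j) ζ‖ ^ 2 := by
  simp only [EllTwo.norm_sq_eq_tsum]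
  rw [← Summable.tsum_finsetSum fun j _ =>
    EllTwo.summable_norm_sq (lpMap (PiLp.proj (𝕜 := ℂ) 2 (fun _ : Fin k => H) j) ζ)]
  refine tsum_congr fun n => ?_
  rw [PiLp.norm_sq_eq_of_L2]
  rfl

/-- The isometry from `ℓ₂(ℓ₂ᵏ(H))` onto `ℓ₂ᵏ(ℓ₂ ⊗ H)`. -/
def tensorCoords (H : Type*) [NormedAddCommGroup H] [InnerProductSpace ℂ H] (k : ℕ) :
    EllTwo (PiLp 2 (fun _ : Fin k => H)) →ₗᵢ[ℂ] PiLp 2 (fun _ : Fin k => EllTwoTensor H) where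
  toFun ζ := WithLp.toLp 2 fun j =>
    toTensor H (lpMap (PiLp.proj (𝕜 := ℂ) 2 (fun _ : Fin k => H) j) ζ)
  map_add' ζ ζ' := by ext j; simp
  map_smul' c ζ := by ext j; simp
  norm_map' ζ := by
    rw [← sq_eq_sq₀ (norm_nonneg _) (norm_nonneg _), norm_sq_eq_sum_lpMap_proj,
      PiLp.norm_sq_eq_of_L2]
    refine Finset.sum_congr rfl fun j _ => ?_
    change ‖toTensor H _‖ ^ 2 = _
    rw [LinearIsometry.norm_map]

theorem tensorCoords_apply (ζ : EllTwo (PiLp 2 (fun _ : Fin k => H))) (j : Fin k) :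
    tensorCoords H k ζ j
      = toTensor H (lpMap (PiLp.proj (𝕜 := ℂ) 2 (fun _ : Fin k => H) j) ζ) := rfl

theorem tensorCoords_surjective [CompleteSpace H] : Function.Surjective (tensorCoords H k) := by
  intro v
  choose ξ hξ using fun j => toTensor_surjective (v j)
  refine ⟨∑ j, lpMap (coordInclusion H j) (ξ j), ?_⟩
  ext i
  rw [tensorCoords_apply, ← hξ i]
  congr 1
  ext n
  rw [map_sum, EllTwo.sum_apply]
  simp [coordInclusion_apply]

theorem matrixOp_ampliation_tensorCoords (T : Matrix (Fin k) (Fin k) (H →L[ℂ] H))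
    (ζ : EllTwo (PiLp 2 (fun _ : Fin k => H))) :
    matrixOp (T.map ampliation) (tensorCoords H k ζ)
      = tensorCoords H k (lpMap (matrixOp T) ζ) := by
  ext i
  simp only [matrixOp_apply, tensorCoords_apply, Matrix.map_apply, ampliation_toTensor]
  rw [← map_sum]
  congr 1
  ext n
  rw [EllTwo.sum_apply]
  simp [matrixOp_apply]

/-- Regrouping `ℓ₂ᵏ(ℓ₂ ⊗ H)` as `ℓ₂(ℓ₂ᵏ(H))` turns the matrix of ampliations into the direct sum of
copies of `matrixOp T`. -/
theorem norm_matrixOp_ampliation_le [CompleteSpace H] (T : Matrix (Fin k) (Fin k) (H →L[ℂ] H)) :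
    ‖matrixOp (T.map ampliation)‖ ≤ ‖matrixOp T‖ := by
  refine ContinuousLinearMap.opNorm_le_bound _ (norm_nonneg _) fun v => ?_
  obtain ⟨ζ, rfl⟩ := tensorCoords_surjective v
  rw [matrixOp_ampliation_tensorCoords, LinearIsometry.norm_map, LinearIsometry.norm_map]
  exact norm_lpMap_apply_le _ ζ

theorem inner_matrixOp_tensorCoords_shift [CompleteSpace H]
    (T : Matrix (Fin k) (Fin k) (H →L[ℂ] H)) (n : ℕ)
    (ξ η : EllTwo (PiLp 2 (fun _ : Fin k => H))) :
    inner ℂ (tensorCoords H k (shift n η))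
        (matrixOp (T.map ampliation) (tensorCoords H k (shift n ξ)))
      = pairing ξ η (matrixOp T) := by
  rw [matrixOp_ampliation_tensorCoords, LinearIsometry.inner_map_map, lpMap_shift,
    LinearIsometry.inner_map_map, pairing_apply]

theorem inner_tensorCoords_shift_of_ne [CompleteSpace H] {n m l : ℕ} (h : n ≠ m)
    (a : H →L[ℂ] H) (η : EllTwo (PiLp 2 (fun _ : Fin k => H)))
    (ξ : EllTwo (PiLp 2 (fun _ : Fin l => H))) (i : Fin k) (j : Fin l) :
    inner ℂ (tensorCoords H k (shift n η) i)
      (ampliation a (tensorCoords H l (shift m ξ) j)) = 0 := by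
  rw [tensorCoords_apply, tensorCoords_apply, ampliation_toTensor, LinearIsometry.inner_map_map,
    lpMap_shift, lpMap_shift, lpMap_shift, inner_shift_of_ne h]

theorem inner_tensorCoords_shift [CompleteSpace H] (n : ℕ) (a : H →L[ℂ] H)
    (ξ η : EllTwo (PiLp 2 (fun _ : Fin k => H))) (i j : Fin k) :
    inner ℂ (tensorCoords H k (shift n η) i)
      (ampliation a (tensorCoords H k (shift n ξ) j))
      = pairing ξ η (matrixOp (Matrix.single i j a)) := by
  rw [tensorCoords_apply, tensorCoords_apply, ampliation_toTensor, LinearIsometry.inner_map_map,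
    lpMap_shift, lpMap_shift, lpMap_shift, LinearIsometry.inner_map_map, pairing_apply_eq_tsum,
    lp.inner_eq_tsum]
  refine tsum_congr fun m => ?_
  rw [inner_matrixOp, Finset.sum_eq_single i, Finset.sum_eq_single j]
  · simp
  · intro j' _ hj
    rw [Matrix.single_apply_of_col_ne _ _ hj.symm]
    simp
  · simp
  · intro i' _ hi
    refine Finset.sum_eq_zero fun j' _ => ?_
    rw [Matrix.single_apply_of_row_ne hi.symm]
    simp
  · simp

theorem continuous_pairing (T : H →L[ℂ] H) :
    Continuous fun p : EllTwo H × EllTwo H => pairing p.1 p.2 T := by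
  simp only [pairing_apply]
  fun_prop

end MatrixAmpliation

/-! ### Choice of the subspace and the completely isometric representation of `A/J` -/

section Quotient

variable {H : Type*} [NormedAddCommGroup H] [InnerProductSpace ℂ H]

theorem separableSpace_piLp (H : Type*) [NormedAddCommGroup H] [InnerProductSpace ℂ H]
    [TopologicalSpace.SeparableSpace H] (k : ℕ) :
    TopologicalSpace.SeparableSpace (PiLp 2 (fun _ : Fin k => H)) :=
  let e := (PiLp.continuousLinearEquiv 2 ℂ (fun _ : Fin k => H)).symm
  e.surjective.denseRange.separableSpace e.continuous

theorem norm_pairing_le_of_mem_closure {D : Set (EllTwo H × EllTwo H)} {T : H →L[ℂ] H} {r : ℝ}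
    (h : ∀ p ∈ D, ‖pairing p.1 p.2 T‖ ≤ r * (‖p.1‖ * ‖p.2‖)) {p : EllTwo H × EllTwo H}
    (hp : p ∈ closure D) : ‖pairing p.1 p.2 T‖ ≤ r * (‖p.1‖ * ‖p.2‖) := by
  have hcl : IsClosed {p : EllTwo H × EllTwo H | ‖pairing p.1 p.2 T‖ ≤ r * (‖p.1‖ * ‖p.2‖)} :=
    isClosed_le (continuous_pairing T).norm (by fun_prop)
  exact closure_minimal h hcl hp

/-- An ideal of an algebra of operators, as a subspace of `B(H)`. -/
def idealSubmodule {A : Subalgebra ℂ (H →L[ℂ] H)} (J : Ideal A) : Submodule ℂ (H →L[ℂ] H) :=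
  (J.restrictScalars ℂ).map A.val.toLinearMap

/-- The pairs of sequences whose normal functional annihilates the matrices over an ideal. -/
def preannihilator {A : Subalgebra ℂ (H →L[ℂ] H)} (J : Ideal A) (k : ℕ) :
    Set (EllTwo (PiLp 2 (fun _ : Fin k => H)) × EllTwo (PiLp 2 (fun _ : Fin k => H))) :=
  {p | ∀ T ∈ matrixSubmodule (idealSubmodule J) k, pairing p.1 p.2 T = 0}

theorem exists_countable_dense_preannihilator [TopologicalSpace.SeparableSpace H]
    {A : Subalgebra ℂ (H →L[ℂ] H)} (J : Ideal A) (k : ℕ) :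
    ∃ D ⊆ preannihilator J k, D.Countable ∧ preannihilator J k ⊆ closure D := by
  have := separableSpace_piLp H k
  have := separableSpace_ellTwo (PiLp 2 (fun _ : Fin k => H))
  exact (TopologicalSpace.IsSeparable.of_separableSpace
    (preannihilator J k)).exists_countable_dense_subset

theorem eq_quotientMatrixNorm {A : Subalgebra ℂ (H →L[ℂ] H)} {J : Ideal A} {k : ℕ}
    {x : Matrix (Fin k) (Fin k) (A ⧸ J)} {r : ℝ}
    (hle : ∀ y : Matrix (Fin k) (Fin k) A,
      (∀ i j, (Submodule.Quotient.mk (y i j) : A ⧸ J) = x i j) →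
        r ≤ ‖matrixOp (y.map fun a => (a : H →L[ℂ] H))‖)
    (hex : ∃ y : Matrix (Fin k) (Fin k) A,
      (∀ i j, (Submodule.Quotient.mk (y i j) : A ⧸ J) = x i j) ∧
        ‖matrixOp (y.map fun a => (a : H →L[ℂ] H))‖ ≤ r) :
    r = quotientMatrixNorm J x := by
  obtain ⟨y, hy, hyr⟩ := hex
  have hlb : ∀ s ∈ {s : ℝ | ∃ y : Matrix (Fin k) (Fin k) A,
      (∀ i j, (Submodule.Quotient.mk (y i j) : A ⧸ J) = x i j) ∧
        s = ‖matrixOp (y.map fun a => (a : H →L[ℂ] H))‖}, r ≤ s := by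
    rintro _ ⟨z, hz, rfl⟩
    exact hle z hz
  exact le_antisymm (le_csInf ⟨_, y, hy, rfl⟩ hlb)
    (le_trans (csInf_le ⟨r, hlb⟩ ⟨y, hy, rfl⟩) hyr)

variable [CompleteSpace H]

/-- The representation `a ↦ I ⊗ a` of an algebra of operators. -/
def ampliationRep (A : Subalgebra ℂ (H →L[ℂ] H)) :
    A →ₐ[ℂ] (EllTwoTensor H →L[ℂ] EllTwoTensor H) :=
  (ampliationHom H).comp A.val

/-- Countably many functionals in the preannihilators are realized by vectors of `ℓ₂ ⊗ H`. -/
theorem exists_family {A : Subalgebra ℂ (H →L[ℂ] H)} (J : Ideal A)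
    (D : ∀ k, Set (EllTwo (PiLp 2 (fun _ : Fin k => H)) × EllTwo (PiLp 2 (fun _ : Fin k => H))))
    (hD : ∀ k, (D k).Countable) (hDJ : ∀ k, D k ⊆ preannihilator J k) :
    ∃ v : (Σ i : Σ k, D k, Fin i.1) → EllTwoTensor H, ∀ k, ∀ p ∈ D k,
      ∃ u w : PiLp 2 (fun _ : Fin k => EllTwoTensor H),
        (∀ j, u j ∈ orbit (ampliationRep A) ⊤ v) ∧
        (∀ i, w i ∈ (orbit (ampliationRep A) J v)ᗮ) ∧
        ‖u‖ = ‖p.1‖ ∧ ‖w‖ = ‖p.2‖ ∧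
        ∀ x : Matrix (Fin k) (Fin k) (H →L[ℂ] H),
          inner ℂ w (matrixOp (x.map ampliation) u) = pairing p.1 p.2 (matrixOp x) := by
  have : ∀ k, Countable (D k) := fun k => (hD k).to_subtype
  -- One numbering for all sizes `k` together, so that a single family serves every matrix level.
  obtain ⟨c, hc⟩ := exists_injective_nat (Σ k, D k)
  let v : (Σ i : Σ k, D k, Fin i.1) → EllTwoTensor H := fun s =>
    tensorCoords H s.1.1 (shift (c s.1) s.1.2.1.1) s.2
  refine ⟨v, fun k p hp => ⟨tensorCoords H k (shift (c ⟨k, p, hp⟩) p.1),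
    tensorCoords H k (shift (c ⟨k, p, hp⟩) p.2), fun j => ?_, fun i => ?_, ?_, ?_, fun x => ?_⟩⟩
  · have h := mem_orbit (v := v) (ampliationRep A) (I := ⊤) (a := 1)
      Submodule.mem_top ⟨⟨k, p, hp⟩, j⟩
    rwa [map_one] at h
  · set w := tensorCoords H k (shift (c ⟨k, p, hp⟩) p.2) i with hw
    have hle : orbit (ampliationRep A) J v
        ≤ (⊥ : ClosedSubmodule ℂ ℂ).comap (innerSL ℂ w) := by
      refine orbit_le _ _ fun a ha s => ?_
      obtain ⟨⟨l, q, hq⟩, j⟩ := s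
      change inner ℂ w (ampliation (a : H →L[ℂ] H)
        (tensorCoords H l (shift (c ⟨l, q, hq⟩) q.1) j)) = 0
      -- In the same block the inner product is the functional of `p` at the matrix with single
      -- entry `a ∈ J`, which `p` annihilates. Different blocks are orthogonal, and ampliations
      -- preserve them.
      by_cases h : (⟨k, p, hp⟩ : Σ k, D k) = ⟨l, q, hq⟩
      · cases h
        rw [inner_tensorCoords_shift]
        refine hDJ k hp _ (mem_matrixSubmodule.2 fun i' j' => ?_)
        rw [entry_matrixOp, Matrix.single_apply]
        split_ifs
        · exact ⟨a, ha, rfl⟩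
        · exact Submodule.zero_mem _
      · exact inner_tensorCoords_shift_of_ne (hc.ne h) _ _ _ _ _
    exact fun n hn => inner_eq_zero_symm.1 (hle hn)
  · rw [LinearIsometry.norm_map, LinearIsometry.norm_map]
  · rw [LinearIsometry.norm_map, LinearIsometry.norm_map]
  · exact inner_matrixOp_tensorCoords_shift x _ p.1 p.2

/-- The distance formula for `M_k(J)` yields an operator on `ℓ₂ᵏ(H)` that differs from `x` by
entries in `J`; its entries are therefore in `A`. -/
theorem exists_representative {A : Subalgebra ℂ (H →L[ℂ] H)} {J : Ideal A}
    (hJ : IsWeakStarClosed (idealSubmodule J : Set (H →L[ℂ] H))) {k : ℕ}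
    (x : Matrix (Fin k) (Fin k) A) {r : ℝ} (hr : 0 ≤ r)
    (h : ∀ p ∈ preannihilator J k,
      ‖pairing p.1 p.2 (matrixOp (x.map fun a => (a : H →L[ℂ] H)))‖ ≤ r * (‖p.1‖ * ‖p.2‖)) :
    ∃ y : Matrix (Fin k) (Fin k) A, (∀ i j, y i j - x i j ∈ J) ∧
      ‖matrixOp (y.map fun a => (a : H →L[ℂ] H))‖ ≤ r := by
  obtain ⟨T, hT, hmem⟩ := exists_norm_le_sub_mem (isWeakStarClosed_matrixSubmodule hJ k)
    (matrixOp (x.map fun a => (a : H →L[ℂ] H))) hr fun ξ η hξη => h (ξ, η) hξη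
  rw [mem_matrixSubmodule] at hmem
  choose b hb hbT using hmem
  refine ⟨x + Matrix.of b, fun i j => ?_, ?_⟩
  · rw [Matrix.add_apply, add_sub_cancel_left]
    exact hb i j
  · convert! hT
    rw [← matrixOp_entry T]
    congr 1
    ext1 i j
    have h1 : (b i j : H →L[ℂ] H) = entry i j T - x i j := by
      have := hbT i j
      rw [map_sub, entry_matrixOp] at this
      exact this
    rw [Matrix.map_apply, Matrix.add_apply, Matrix.of_apply, Subalgebra.coe_add, Matrix.of_apply, h1]
    abel

theorem norm_matrixOp_compressionHom_le {A : Subalgebra ℂ (H →L[ℂ] H)} (J : Ideal A)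
    [J.IsTwoSided] {ι : Type*} (v : ι → EllTwoTensor H) {k : ℕ} (y : Matrix (Fin k) (Fin k) A) :
    ‖matrixOp (y.map (compressionHom (ampliationRep A) J v))‖
      ≤ ‖matrixOp (y.map fun a => (a : H →L[ℂ] H))‖ :=
  (norm_matrixOp_compression_le _ (y.map (ampliationRep A))).trans
    (norm_matrixOp_ampliation_le (y.map fun a => (a : H →L[ℂ] H)))

theorem exists_isometric_family {H : Type u} [NormedAddCommGroup H] [InnerProductSpace ℂ H]
    [CompleteSpace H] [TopologicalSpace.SeparableSpace H]
    {A : Subalgebra ℂ (H →L[ℂ] H)} (J : Ideal A) [J.IsTwoSided]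
    (hJ : IsWeakStarClosed (idealSubmodule J : Set (H →L[ℂ] H))) :
    ∃ (ι : Type u) (v : ι → EllTwoTensor H), ∀ (k : ℕ) (x : Matrix (Fin k) (Fin k) A),
      ∃ y : Matrix (Fin k) (Fin k) A, (∀ i j, y i j - x i j ∈ J) ∧
        ‖matrixOp (y.map fun a => (a : H →L[ℂ] H))‖
          ≤ ‖matrixOp (x.map (compressionHom (ampliationRep A) J v))‖ := by
  choose D hDJ hD hdense using exists_countable_dense_preannihilator J
  obtain ⟨v, hv⟩ := exists_family J D hD hDJ
  refine ⟨_, v, fun k x => exists_representative hJ x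
    (norm_nonneg (matrixOp (x.map (compressionHom (ampliationRep A) J v)))) fun p hp => ?_⟩
  refine norm_pairing_le_of_mem_closure (fun p hp => ?_) (hdense k hp)
  obtain ⟨u, w, hu, hw, hun, hwn, hx⟩ := hv k p hp
  rw [← hx, ← hun, ← hwn]
  exact norm_inner_matrixOp_le (ampliationRep A) J v x hu hw

/-- The representation of `A/J` by compressions to a semi-invariant subspace. -/
def quotientRep {A : Subalgebra ℂ (H →L[ℂ] H)} (J : Ideal A) [J.IsTwoSided] {ι : Type*}
    (v : ι → EllTwoTensor H) :
    A ⧸ J →ₐ[ℂ] ((semiInvariant (ampliationRep A) J v).toSubmodule →L[ℂ]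
      (semiInvariant (ampliationRep A) J v).toSubmodule) :=
  Ideal.Quotient.liftₐ J (compressionHom (ampliationRep A) J v) fun _ ha =>
    compressionHom_eq_zero (ampliationRep A) J v ha

theorem quotientRep_mk {A : Subalgebra ℂ (H →L[ℂ] H)} (J : Ideal A) [J.IsTwoSided] {ι : Type*}
    (v : ι → EllTwoTensor H) (a : A) :
    quotientRep J v (Ideal.Quotient.mk J a) = compressionHom (ampliationRep A) J v a := rfl

/-- Complete contractivity bounds the compression by every representative, and `hv` supplies a
representative attaining the bound, so the infimum is a minimum. -/
theorem isCompletelyIsometric_quotientRep {A : Subalgebra ℂ (H →L[ℂ] H)} (J : Ideal A)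
    [J.IsTwoSided] {ι : Type*} (v : ι → EllTwoTensor H)
    (hv : ∀ (k : ℕ) (x : Matrix (Fin k) (Fin k) A),
      ∃ y : Matrix (Fin k) (Fin k) A, (∀ i j, y i j - x i j ∈ J) ∧
        ‖matrixOp (y.map fun a => (a : H →L[ℂ] H))‖
          ≤ ‖matrixOp (x.map (compressionHom (ampliationRep A) J v))‖) :
    IsCompletelyIsometric J fun q => quotientRep J v q := by
  intro k x
  have hrep : ∀ y : Matrix (Fin k) (Fin k) A,
      (∀ i j, (Submodule.Quotient.mk (y i j) : A ⧸ J) = x i j) →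
      x.map (fun q => quotientRep J v q) = y.map (compressionHom (ampliationRep A) J v) :=
    fun y hy => Matrix.ext fun i j =>
      (congrArg (quotientRep J v) (hy i j).symm).trans (quotientRep_mk J v (y i j))
  choose y hy using fun i j => Submodule.Quotient.mk_surjective J (x i j)
  refine eq_quotientMatrixNorm (fun z hz => ?_) ?_
  · rw [hrep z hz]
    exact norm_matrixOp_compressionHom_le J v z
  · obtain ⟨z, hz, hzn⟩ := hv k (Matrix.of y)
    rw [← hrep (Matrix.of y) hy] at hzn
    refine ⟨z, fun i j => ?_, hzn⟩
    rw [← hy i j]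
    exact (Submodule.Quotient.eq J).2 (hz i j)

end Quotient

end DualAlgebra

end

theorem corollary5p3 {H : Type*} [NormedAddCommGroup H] [InnerProductSpace ℂ H] [CompleteSpace H]
    [TopologicalSpace.SeparableSpace H]
    (A : Subalgebra ℂ (H →L[ℂ] H))
    (hA : DualAlgebra.IsWeakStarClosed (A : Set (H →L[ℂ] H)))
    (J : Ideal A) [J.IsTwoSided]
    (hJ : DualAlgebra.IsWeakStarClosed ((fun a : A => (a : H →L[ℂ] H)) '' (J : Set A))) :
    ∃ (E : ClosedSubmodule ℂ (DualAlgebra.EllTwoTensor H))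
      (Ψ : A ⧸ J →ₐ[ℂ] (E.toSubmodule →L[ℂ] E.toSubmodule)),
      (∀ a : A, Ψ (Ideal.Quotient.mk J a)
        = DualAlgebra.compression E (DualAlgebra.ampliation (a : H →L[ℂ] H))) ∧
      DualAlgebra.IsCompletelyIsometric J (K := E.toSubmodule) (fun q => Ψ q) := by
  obtain ⟨ι, v, hv⟩ := DualAlgebra.exists_isometric_family J hJ
  exact ⟨DualAlgebra.semiInvariant (DualAlgebra.ampliationRep A) J v,
    DualAlgebra.quotientRep J v, fun a => DualAlgebra.quotientRep_mk J v a,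
    DualAlgebra.isCompletelyIsometric_quotientRep J v hv⟩
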